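/- All graphs are finite and simple. For a connected graph $G$, the conflict-free connection number $cfc(G)$ is the smallest number of colors in a (not necessarily proper) edge-coloring of $G$ such that any two distinct vertices are joined by a path on which some color is used on exactly one edge. The edge-connectivity $\lambda(G)$ is the minimum size of a set of edges whose removal leaves a disconnected graph, $\overline{G}$ is the complement of $G$, and $P_5$ is the path with $5$ vertices. **Theorem.** Let $G$ be a $2$-edge-connected graph of order $n\ge 5$ such that $\lambda(\overline{G})=1$. Then $$4\le cfc(G)+cfc(\overline{G})\le n \qquad\text{and}\qquad 4\le cfc(G)\cdot cfc(\overline{G})\le 2(n-2).$$ Moreover: (i) $cfc(G)+cfc(\overline{G})=n$ if and only if $\overline{G}\cong P_5$, and likewise $cfc(G)\cdot cfc(\overline{G})=2(n-2)$ if and only if $\overline{G}\cong P_5$; (ii) the lower bounds are sharp: for every $n\ge 6$ there is a $2$-edge-connected graph $G$ of order $n$ with $\lambda(\overline{G})=1$ and $cfc(G)+cfc(\overline{G})=cfc(G)\cdot cfc(\overline{G})=4$. -/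

import Mathlib

namespace SimpleGraph

variable {V : Type*}

/-- A walk of an edge-colored graph is conflict-free if some color is used on exactly one of
its edges. It is applied below to paths only. -/
def Walk.IsConflictFree {G : SimpleGraph V} {K : Type*} (c : G.EdgeLabeling K) {u v : V}
    (p : G.Walk u v) : Prop :=
  ∃ i : K, ∃! e : G.edgeSet, (e : Sym2 V) ∈ p.edges ∧ c e = i

/-- An edge-coloring (not necessarily proper) makes the graph conflict-free connected if any two
distinct vertices are joined by a conflict-free path. -/
def IsConflictFreeConnected (G : SimpleGraph V) {K : Type*} (c : G.EdgeLabeling K) : Prop :=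
  ∀ u v : V, u ≠ v → ∃ p : G.Walk u v, p.IsPath ∧ p.IsConflictFree c

/-- The conflict-free connection number of a (connected, finite) graph: the smallest number of
colors of an edge-coloring that makes the graph conflict-free connected. -/
noncomputable def cfc (G : SimpleGraph V) : ℕ :=
  sInf {k : ℕ | ∃ c : G.EdgeLabeling (Fin k), G.IsConflictFreeConnected c}

/-- The edge-connectivity of a finite graph with at least two vertices: the minimum size of a set
of edges whose removal leaves a disconnected graph. -/
noncomputable def edgeConnectivity (G : SimpleGraph V) : ℕ :=
  sInf {k : ℕ | ∃ S : Finset (Sym2 V),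
    (S : Set (Sym2 V)) ⊆ G.edgeSet ∧ S.card = k ∧ ¬ (G.deleteEdges (S : Set (Sym2 V))).Connected}

end SimpleGraph

namespace SimpleGraph

variable {V : Type*}

/-! Let `ab` be a bridge of the complement. Then `G` contains every pair between the two sides of
the bridge except `ab`, and two colors suffice for `G`. If both sides have a second vertex, it is
enough to single out one edge `a'b'` disjoint from `ab` (`cfc_le_two_of_bipartite`). If one side is
a single vertex, that vertex misses only one other in `G`, and minimum degree two does the rest
(`cfc_le_two_of_almost_universal`). Since `a` and `b` are not adjacent, `G.cfc = 2`.

Minimum degree two in `G` says that in the complement every vertex misses two others, so `Gᶜ.cfc` is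
at least 2. For n ≥ 6 every spanning tree of the complement then contains three disjoint edges or
two disjoint paths on three vertices; of its n - 1 distinct colors, two are saved by repeating
colors there (`exists_isConflictFreeConnected_of_recolor`), leaving n - 3. For n = 5 the complement
must be P₅, whose number is 3 = n - 2. The bounds and the equality cases follow from these values.
-/

/-- Two vertices are joined by a path having an edge whose color, under a coloring of all pairs of
vertices, is used on no other edge of that path. -/
def CFJoined {K : Type*} (G : SimpleGraph V) (c : Sym2 V → K) (u v : V) : Prop :=
  ∃ p : G.Walk u v, p.IsPath ∧ ∃ e ∈ p.edges, ∀ e' ∈ p.edges, c e' = c e → e' = e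

/-! ### Short conflict-free paths, and counting colors on a subgraph. -/

section CFJoined

variable {K : Type*} {G : SimpleGraph V} {c : Sym2 V → K}

lemma CFJoined.symm {u v : V} (h : G.CFJoined c u v) : G.CFJoined c v u := by
  obtain ⟨p, hp, e, he, h⟩ := h
  exact ⟨p.reverse, hp.reverse, e, by simpa using he, by simpa using h⟩

lemma Adj.cfJoined {u v : V} (h : G.Adj u v) : G.CFJoined c u v :=
  ⟨h.toWalk, by simp [h.ne], s(u, v), by simp, by simp⟩

lemma cfJoined_of_two_edges {x y z : V} (hxy : G.Adj x y) (hyz : G.Adj y z) (hxz : x ≠ z)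
    (hc : c s(x, y) ≠ c s(y, z)) : G.CFJoined c x z := by
  refine ⟨.cons hxy (.cons hyz .nil), ?_, s(x, y), by simp, ?_⟩
  · simp [hxy.ne, hyz.ne, hxz]
  · simp [hc.symm]

/-- With two colors, three edges that are not all alike split 2 + 1, so some color occurs once. -/
lemma cfJoined_of_three_edges {c : Sym2 V → Bool} {x y z w : V} (hxy : G.Adj x y) (hyz : G.Adj y z)
    (hzw : G.Adj z w) (hxz : x ≠ z) (hxw : x ≠ w) (hyw : y ≠ w)
    (hc : ¬ (c s(x, y) = c s(y, z) ∧ c s(y, z) = c s(z, w))) : G.CFJoined c x w := by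
  refine ⟨.cons hxy (.cons hyz (.cons hzw .nil)), ?_, ?_⟩
  · simp [hxy.ne, hyz.ne, hzw.ne, hxz, hxw, hyw]
  · simp only [Walk.edges_cons, Walk.edges_nil, List.mem_cons, List.not_mem_nil, or_false,
      exists_eq_or_imp, exists_eq_left, forall_eq_or_imp, forall_eq]
    grind

lemma cfJoined_of_four_edges {x y z w t : V} (hxy : G.Adj x y) (hyz : G.Adj y z)
    (hzw : G.Adj z w) (hwt : G.Adj w t) (hd : [x, y, z, w, t].Nodup)
    (h₁ : c s(x, y) ≠ c s(z, w)) (h₂ : c s(y, z) ≠ c s(z, w)) (h₃ : c s(w, t) ≠ c s(z, w)) :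
    G.CFJoined c x t := by
  refine ⟨.cons hxy (.cons hyz (.cons hzw (.cons hwt .nil))), ?_, s(z, w), by simp, ?_⟩
  · simpa [Walk.isPath_def] using hd
  · simp [h₁, h₂, h₃]

lemma CFJoined.exists_isConflictFree {k : ℕ} {s : Finset K} {g : K → Fin k}
    (hg : Set.InjOn g s) {u v : V} {T : SimpleGraph V} (hT : T ≤ G)
    (hs : ∀ e ∈ T.edgeSet, c e ∈ s) (h : T.CFJoined c u v) :
    ∃ p : G.Walk u v, p.IsPath ∧ p.IsConflictFree (fun e : G.edgeSet ↦ g (c e)) := by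
  obtain ⟨p, hp, e, he, h⟩ := h
  have hpT : ∀ e ∈ p.edges, e ∈ T.edgeSet := fun e he ↦ p.edges_subset_edgeSet he
  refine ⟨p.mapLe hT, hp.mapLe hT, g (c e), ⟨e, edgeSet_mono hT (hpT e he)⟩,
    ⟨by simpa using he, rfl⟩, ?_⟩
  rintro ⟨e', he'⟩ ⟨h₁, h₂⟩
  replace h₁ : e' ∈ p.edges := by simpa using h₁
  exact Subtype.ext (h e' h₁ (hg (hs _ (hpT _ h₁)) (hs _ (hpT _ he)) h₂))

lemma exists_injOn_fin {k : ℕ} (hk : 0 < k) (s : Finset K) (hs : s.card ≤ k) :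
    ∃ g : K → Fin k, Set.InjOn g s := by
  classical
  let f : s → Fin k := fun x ↦ Fin.castLE hs (s.equivFin x)
  have hf : Function.Injective f := (Fin.castLE_injective hs).comp s.equivFin.injective
  refine ⟨fun x ↦ if h : x ∈ s then f ⟨x, h⟩ else ⟨0, hk⟩, fun x hx y hy hxy ↦ ?_⟩
  have hx' : x ∈ s := hx
  have hy' : y ∈ s := hy
  simp only [hx', hy', dif_pos] at hxy
  simpa using hf hxy

/-- The joining paths stay in `T`, so only colors on `T` count; edges of `G` outside `T` may receive
any color. -/
lemma exists_isConflictFreeConnected_of_cfJoined {k : ℕ} (hk : 0 < k) {T : SimpleGraph V}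
    (hT : T ≤ G) (s : Finset K) (hs : s.card ≤ k) (hc : ∀ e ∈ T.edgeSet, c e ∈ s)
    (h : ∀ u v, u ≠ v → T.CFJoined c u v) :
    ∃ c : G.EdgeLabeling (Fin k), G.IsConflictFreeConnected c := by
  obtain ⟨g, hg⟩ := exists_injOn_fin hk s hs
  exact ⟨fun e ↦ g (c e), fun u v huv ↦ (h u v huv).exists_isConflictFree hg hT hc⟩

lemma cfc_le_two_of_cfJoined {c : Sym2 V → Bool} (h : ∀ u v, u ≠ v → G.CFJoined c u v) :
    G.cfc ≤ 2 :=
  Nat.sInf_le (exists_isConflictFreeConnected_of_cfJoined two_pos le_rfl Finset.univ (by simp)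
    (by simp) h)

lemma Walk.const_on_support {ι : Type*} {κ : V → ι} {u v : V} (p : G.Walk u v)
    (h : ∀ x y, s(x, y) ∈ p.edges → κ x = κ y) : ∀ x ∈ p.support, κ x = κ u := by
  induction p with
  | nil => simp
  | @cons u v w huv q ih =>
    have h₁ : κ u = κ v := h u v (by simp)
    intro x hx
    rw [Walk.support_cons, List.mem_cons] at hx
    rcases hx with rfl | hx
    · rfl
    · rw [h₁]
      exact ih (fun x y hxy ↦ h x y (by simp [hxy])) x hx

/-- If edges sharing their color lie within distinct classes of a vertex partition, then every path
has an edge of unique color. -/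
lemma cfJoined_of_partition (hG : G.Connected) {ι : Type*} (κ : V → ι)
    (h : ∀ x y z w, G.Adj x y → G.Adj z w → s(x, y) ≠ s(z, w) → c s(x, y) = c s(z, w) →
      κ x = κ y ∧ κ x ≠ κ z) (u v : V) (huv : u ≠ v) : G.CFJoined c u v := by
  obtain ⟨p, hp⟩ := hG.preconnected.exists_isPath u v
  refine ⟨p, hp, ?_⟩
  -- Otherwise each edge of the path shares its color with another one. Then all edges lie inside
  -- classes, so the path stays in one class, yet the partner of its first edge lies in a different
  -- class.
  by_contra! hcon
  have hκ : ∀ x y, s(x, y) ∈ p.edges → κ x = κ y := by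
    intro x y hxy
    obtain ⟨e, he, hce, hne⟩ := hcon _ hxy
    induction e with | _ z w
    exact (h x y z w (p.adj_of_mem_edges hxy) (p.adj_of_mem_edges he) hne.symm hce.symm).1
  have hsupp := p.const_on_support hκ
  cases p with
  | nil => exact huv rfl
  | @cons _ y _ hadj q =>
    obtain ⟨e, he, hce, hne⟩ := hcon s(u, y) (by simp)
    induction e with | _ z w
    refine (h u y z w hadj (Walk.adj_of_mem_edges _ he) hne.symm hce.symm).2 ?_
    exact (hsupp z (Walk.fst_mem_support_of_mem_edges _ he)).symm

end CFJoined

/-! ### The lower bound 2. -/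

section LowerBounds

variable {G : SimpleGraph V}

/-- With at most one color, a conflict-free path is a single edge. Nonemptiness is needed because
`sInf ∅ = 0`. -/
lemma two_le_cfc {u v : V} (huv : u ≠ v) (hadj : ¬ G.Adj u v)
    (h : {k : ℕ | ∃ c : G.EdgeLabeling (Fin k), G.IsConflictFreeConnected c}.Nonempty) :
    2 ≤ G.cfc := by
  obtain ⟨c, hc⟩ := Nat.sInf_mem h
  change 2 ≤ sInf _
  generalize sInf {k : ℕ | ∃ c : G.EdgeLabeling (Fin k), G.IsConflictFreeConnected c} = k at c hc
  by_contra! hk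
  have : Subsingleton (Fin k) := Fin.subsingleton_iff_le_one.mpr (by omega)
  obtain ⟨p, hp, i, e, ⟨he, hi⟩, huniq⟩ := hc u v huv
  have key : ∀ e' ∈ p.edges, e' = e := fun e' he' ↦
    congrArg Subtype.val (huniq ⟨e', p.edges_subset_edgeSet he'⟩ ⟨he', Subsingleton.elim _ _⟩)
  cases p with
  | nil => exact huv rfl
  | @cons _ y _ h₁ q =>
    cases q with
    | nil => exact hadj h₁
    | @cons _ z _ h₂ r =>
      have h := (key s(u, y) (by simp)).trans (key s(y, z) (by simp)).symm
      have := hp.isTrail.edges_nodup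
      simp only [Walk.edges_cons, List.nodup_cons, List.mem_cons, not_or] at this
      exact this.1.1 h

end LowerBounds

/-! ### Two-colorings of `G`. -/

section Colorings

variable {G : SimpleGraph V}

/-- A graph containing a complete bipartite graph minus an edge `s(a, b)`, both sides having another
vertex, is conflict-free connected with two colors. -/
lemma cfc_le_two_of_bipartite {A : Set V} {a b a' b' : V} (ha : a ∈ A) (hb : b ∉ A) (ha' : a' ∈ A)
    (hb' : b' ∉ A) (haa' : a ≠ a') (hbb' : b ≠ b')
    (hG : ∀ x ∈ A, ∀ y ∉ A, ¬ (x = a ∧ y = b) → G.Adj x y) : G.cfc ≤ 2 := by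
  classical
  -- Only `a'b'` is `true`, so every path through it is conflict-free.
  let c : Sym2 V → Bool := fun e ↦ decide (e = s(a', b'))
  have hc : c s(a', b') = true := by simp [c]
  have hc' : c s(b', a') = true := by simp [c, Sym2.eq_swap]
  have hcf : ∀ x y, ¬ (x = a' ∧ y = b' ∨ x = b' ∧ y = a') → c s(x, y) = false := by
    intro x y h
    simpa [c] using h
  have hAadj : ∀ x ∈ A, ∀ y ∉ A, ¬ (x = a ∧ y = b) → G.Adj y x := fun x hx y hy h ↦
    (hG x hx y hy h).symm
  have hsideA : ∀ x ∈ A, ∀ y ∈ A, x ≠ y → y ≠ a → G.CFJoined c x y := by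
    intro x hx y hy hxy hya
    by_cases hy' : y = a'
    · subst hy'
      exact cfJoined_of_two_edges (y := b') (hG _ hx _ hb' (by grind)) (hAadj _ hy _ hb' (by grind))
        hxy (by rw [hcf _ _ (by grind), hc']; simp)
    by_cases hx' : x = a'
    · subst hx'
      exact cfJoined_of_two_edges (y := b') (hG _ hx _ hb' (by grind)) (hAadj _ hy _ hb' (by grind))
        hxy (by rw [hcf b' y (by grind), hc]; simp)
    -- The path `y`, `b`, `a'`, `b'`, `x` needs `y ≠ a`; at most one of the two ends is `a`, so this
    -- holds after a swap.
    refine (cfJoined_of_four_edges (y := b) (z := a') (w := b') (hG _ hy _ hb (by grind))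
      (hAadj _ ha' _ hb (by grind)) (hG _ ha' _ hb' (by grind)) (hAadj _ hx _ hb' (by grind))
      (by simp; grind) ?_ ?_ ?_).symm
    all_goals rw [hc, hcf _ _ (by grind)]; simp
  have hsideB : ∀ x ∉ A, ∀ y ∉ A, x ≠ y → y ≠ b → G.CFJoined c x y := by
    intro x hx y hy hxy hya
    by_cases hy' : y = b'
    · subst hy'
      exact cfJoined_of_two_edges (y := a') (hAadj _ ha' _ hx (by grind)) (hG _ ha' _ hy (by grind))
        hxy (by rw [hcf x a' (by grind), hc]; simp)
    by_cases hx' : x = b'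
    · subst hx'
      exact cfJoined_of_two_edges (y := a') (hAadj _ ha' _ hx (by grind)) (hG _ ha' _ hy (by grind))
        hxy (by rw [hcf a' y (by grind), hc']; simp)
    refine (cfJoined_of_four_edges (y := a) (z := b') (w := a') (hAadj _ ha _ hy (by grind))
      (hG _ ha _ hb' (by grind)) (hAadj _ ha' _ hb' (by grind)) (hG _ ha' _ hx (by grind))
      (by simp; grind) ?_ ?_ ?_).symm
    all_goals rw [hc', hcf _ _ (by grind)]; simp
  have hcross : ∀ x ∈ A, ∀ y ∉ A, G.CFJoined c x y := by
    intro x hx y hy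
    by_cases h : x = a ∧ y = b
    · obtain ⟨rfl, rfl⟩ := h
      refine cfJoined_of_three_edges (y := b') (z := a') (hG _ hx _ hb' (by grind))
        (hAadj _ ha' _ hb' (by grind)) (hG _ ha' _ hy (by grind)) haa' (by grind) hbb'.symm ?_
      rw [hc', hcf _ _ (by grind)]; simp
    · exact (hG x hx y hy h).cfJoined
  refine cfc_le_two_of_cfJoined (c := c) fun u v huv ↦ ?_
  by_cases hu : u ∈ A <;> by_cases hv : v ∈ A
  · by_cases h : v = a
    · exact (hsideA v hv u hu huv.symm (by grind)).symm
    · exact hsideA u hu v hv huv h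
  · exact hcross u hu v hv
  · exact (hcross v hv u hu).symm
  · by_cases h : v = b
    · exact (hsideB v hv u hu huv.symm (by grind)).symm
    · exact hsideB u hu v hv huv h

/-- A graph with minimum degree at least two in which some vertex `a` misses exactly one other
vertex `b` is conflict-free connected with two colors. -/
lemma cfc_le_two_of_almost_universal [Finite V] {a b : V} (hab : a ≠ b) (hnab : ¬ G.Adj a b)
    (ha : ∀ x, x ≠ a → x ≠ b → G.Adj a x)
    (hdeg : ∀ v, ∃ w₁ w₂, w₁ ≠ w₂ ∧ G.Adj v w₁ ∧ G.Adj v w₂) : G.cfc ≤ 2 := by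
  classical
  obtain ⟨d, hbd⟩ : ∃ d, G.Adj b d := ⟨_, (hdeg b).choose_spec.choose_spec.2.1⟩
  have hda : d ≠ a := by rintro rfl; exact hnab hbd.symm
  -- `S` is a maximal independent set avoiding `a`, `b`, `d`. Edges from `a` to `S` are `false` and
  -- other edges at `a` are `true`, so vertices on different sides of `S` are joined through `a`.
  -- Independence serves pairs inside `S`, maximality pairs outside it.
  obtain ⟨S, hS⟩ : ∃ S : Set V, Maximal (fun S : Set V ↦
      (∀ x ∈ S, x ≠ a ∧ x ≠ b ∧ x ≠ d) ∧ ∀ x ∈ S, ∀ y ∈ S, ¬ G.Adj x y) S :=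
    (Set.toFinite _).exists_maximal
      ⟨∅, ⟨fun x hx ↦ hx.elim, fun x hx ↦ hx.elim⟩⟩
  obtain ⟨hSne, hSind⟩ := hS.prop
  have hSdom : ∀ x ∉ S, x ≠ a → x ≠ b → x ≠ d → ∃ y ∈ S, G.Adj x y := by
    intro x hx hxa hxb hxd
    by_contra! hcon
    refine hx (hS.le_of_ge (y := insert x S) ⟨?_, ?_⟩ (Set.subset_insert x S)
      (Set.mem_insert x S))
    · grind
    · rintro y (rfl | hy) z (rfl | hz)
      · simp
      · exact hcon z hz
      · exact fun h ↦ hcon y hy h.symm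
      · exact hSind y hy z hz
  let c : Sym2 V → Bool := fun e ↦ decide (∃ x, x ∉ S ∧ x ≠ b ∧ e = s(a, x))
  have hca : ∀ x, x ≠ b → c s(a, x) = decide (x ∉ S) := by
    intro x hx
    by_cases h : x ∈ S
    · simp only [c, h, not_true_eq_false, decide_false, decide_eq_false_iff_not]
      rintro ⟨y, hy, -, he⟩
      rw [Sym2.congr_right] at he
      exact hy (he ▸ h)
    · simp only [c, h, not_false_eq_true, decide_true, decide_eq_true_eq]
      exact ⟨x, h, hx, rfl⟩
  have hca' : ∀ x, x ≠ b → c s(x, a) = decide (x ∉ S) := fun x hx ↦ by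
    rw [Sym2.eq_swap, hca x hx]
  have hcf : ∀ x y, x ≠ a → y ≠ a → c s(x, y) = false := by
    intro x y hx hy
    simp only [c, decide_eq_false_iff_not]
    rintro ⟨z, -, -, he⟩
    rw [Sym2.eq_iff] at he
    grind
  have hdS : d ∉ S := fun h ↦ (hSne d h).2.2 rfl
  have had : G.Adj a d := ha d hda hbd.ne'
  -- Both colors occur on the path `x`, `y`, `a`, `z`.
  have hthree : ∀ x y z, G.Adj x y → x ≠ a → x ≠ b → x ≠ z → y ≠ a → y ≠ b → z ≠ a → z ≠ b →
      ¬ (y ∈ S ↔ z ∈ S) → G.CFJoined c x z := by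
    intro x y z hxy hxa hxb hxz hya hyb hza hzb h
    refine cfJoined_of_three_edges hxy (ha y hya hyb).symm (ha z hza hzb) hxa hxz (by grind) ?_
    rw [hca z hzb, hca' y hyb]
    grind
  have hneighbor : ∀ x, x ≠ a → x ≠ b → (∃ y, G.Adj x y ∧ y ≠ a ∧ y ≠ b) ∨ G.Adj x b := by
    intro x hxa hxb
    obtain ⟨w₁, w₂, hne, h₁, h₂⟩ := hdeg x
    grind
  have hmain : ∀ x y, x ≠ a → x ≠ b → y ≠ a → y ≠ b → x ≠ y → y ≠ d → G.CFJoined c x y := by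
    intro x y hxa hxb hya hyb hxy hyd
    by_cases hxS : x ∈ S <;> by_cases hyS : y ∈ S
    · rcases hneighbor x hxa hxb with ⟨z, hxz, hza, hzb⟩ | hx
      · exact hthree x z y hxz hxa hxb hxy hza hzb hya hyb (by grind)
      rcases hneighbor y hya hyb with ⟨z, hyz, hza, hzb⟩ | hy
      · exact (hthree y z x hyz hya hyb hxy.symm hza hzb hxa hxb (by grind)).symm
      -- Now `b` is adjacent to both, and `x`, `b`, `d`, `a`, `y` has `da` as its only `true` edge.
      refine cfJoined_of_four_edges hx hbd had.symm (ha y hya hyb) ?_ ?_ ?_ ?_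
      · have := hSne x hxS
        have := hSne y hyS
        have := hbd.ne
        simp
        grind
      · rw [hcf x b hxa hab.symm, hca' d hbd.ne']; simp [hdS]
      · rw [hcf b d hab.symm hda, hca' d hbd.ne']; simp [hdS]
      · rw [hca y hyb, hca' d hbd.ne']; simp [hdS, hyS]
    · exact cfJoined_of_two_edges (ha x hxa hxb).symm (ha y hya hyb) hxy
        (by rw [hca' x hxb, hca y hyb]; simp [hxS, hyS])
    · exact cfJoined_of_two_edges (ha x hxa hxb).symm (ha y hya hyb) hxy
        (by rw [hca' x hxb, hca y hyb]; simp [hxS, hyS])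
    · obtain ⟨z, hzS, hyz⟩ := hSdom y hyS hya hyb hyd
      have := hSne z hzS
      exact (hthree y z x hyz hya hyb hxy.symm this.1 this.2.1 hxa hxb (by grind)).symm
  have hb : ∀ x, x ≠ b → G.CFJoined c b x := by
    intro x hxb
    by_cases hxa : x = a
    · subst hxa
      exact cfJoined_of_two_edges hbd had.symm hab.symm
        (by rw [hcf b d hab.symm hda, hca' d hbd.ne']; simp [hdS])
    by_cases hxd : x = d
    · subst hxd
      exact hbd.cfJoined
    refine cfJoined_of_three_edges hbd had.symm (ha x hxa hxb) hab.symm hxb.symm (Ne.symm hxd) ?_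
    rw [hcf b d hab.symm hda, hca' d hbd.ne']
    simp [hdS]
  refine cfc_le_two_of_cfJoined (c := c) fun u v huv ↦ ?_
  by_cases hub : u = b
  · exact hub ▸ hb v (by grind)
  by_cases hvb : v = b
  · exact hvb ▸ (hb u hub).symm
  by_cases hua : u = a
  · subst hua
    exact (ha v huv.symm hvb).cfJoined
  by_cases hva : v = a
  · subst hva
    exact (ha u huv hub).symm.cfJoined
  by_cases hvd : v = d
  · exact (hmain v u hva hvb hua hub huv.symm (by grind)).symm
  · exact hmain u v hua hub hva hvb huv hvd

end Colorings

/-! ### Recoloring a spanning tree of the complement. -/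

section Structure

variable {G : SimpleGraph V}

lemma Connected.exists_adj_boundary (hG : G.Connected) {S : Set V} {x y : V} (hx : x ∈ S)
    (hy : y ∉ S) : ∃ z ∈ S, ∃ w ∉ S, G.Adj z w := by
  obtain ⟨p⟩ := hG.preconnected x y
  obtain ⟨d, -, h₁, h₂⟩ := p.exists_boundary_dart S hx hy
  exact ⟨d.fst, h₁, d.snd, h₂, d.adj⟩

/-- In a connected graph in which every vertex misses two other vertices there are a path on five
vertices or two disjoint paths on three vertices. -/
lemma Connected.exists_path_five_or_two_cherries (hG : G.Connected)
    (hN : ∀ v, ∃ w₁ w₂, w₁ ≠ w₂ ∧ w₁ ≠ v ∧ w₂ ≠ v ∧ ¬ G.Adj v w₁ ∧ ¬ G.Adj v w₂) :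
    (∃ p₀ p₁ p₂ p₃ p₄, [p₀, p₁, p₂, p₃, p₄].Nodup ∧
      G.Adj p₀ p₁ ∧ G.Adj p₁ p₂ ∧ G.Adj p₂ p₃ ∧ G.Adj p₃ p₄) ∨
    (∃ x₁ u x₂ y₁ v y₂, [x₁, u, x₂, y₁, v, y₂].Nodup ∧
      G.Adj u x₁ ∧ G.Adj u x₂ ∧ G.Adj v y₁ ∧ G.Adj v y₂) := by
  have step : ∀ u, ∃ z w, G.Adj u z ∧ G.Adj z w ∧ w ≠ u ∧ ¬ G.Adj u w := by
    intro u
    obtain ⟨w, -, -, hwu, -, huw, -⟩ := hN u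
    obtain ⟨z, hz, w', hw', h⟩ := hG.exists_adj_boundary (S := {x | x = u ∨ G.Adj u x})
      (x := u) (y := w) (by simp) (by simp [hwu, huw])
    simp only [Set.mem_ofPred_eq, not_or] at hz hw'
    rcases hz with rfl | hz
    · exact absurd h hw'.2
    · exact ⟨z, w', hz, h, hw'.1, hw'.2⟩
  obtain ⟨x, u, v, y, hnd, hxu, huv, hvy⟩ : ∃ x u v y, [x, u, v, y].Nodup ∧
      G.Adj x u ∧ G.Adj u v ∧ G.Adj v y := by
    obtain ⟨t⟩ := hG.nonempty
    obtain ⟨u, w, htu, huw, hwt, -⟩ := step t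
    obtain ⟨v, y, huv, hvy, hyu, huy⟩ := step u
    obtain ⟨x, hx, hxv⟩ : ∃ x, G.Adj x u ∧ x ≠ v := by
      by_cases h : t = v
      · exact ⟨w, huw.symm, by grind⟩
      · exact ⟨t, htu, h⟩
    refine ⟨x, u, v, y, ?_, hx, huv, hvy⟩
    have : x ≠ y := by rintro rfl; exact huy hx.symm
    have := hx.ne
    have := huv.ne
    have := hvy.ne
    simp
    grind
  simp only [List.nodup_cons, List.mem_cons, List.not_mem_nil, or_false, not_or, List.nodup_nil,
    not_false_eq_true, and_true] at hnd
  -- If the edge `uv` dominates, the vertices missed by `u` are neighbors of `v` and conversely,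
  -- giving two disjoint paths centered at `u` and `v`. If not, a vertex at distance two from the
  -- edge extends it to a path on five vertices.
  by_cases hdom : ∀ w, w = u ∨ w = v ∨ G.Adj u w ∨ G.Adj v w
  · right
    obtain ⟨y₁, y₂, hy, hyu₁, hyu₂, h₁, h₂⟩ := hN u
    obtain ⟨x₁, x₂, hx, hxv₁, hxv₂, h₃, h₄⟩ := hN v
    have hvu := huv.symm
    have e₁ : G.Adj v y₁ := by grind
    have e₂ : G.Adj v y₂ := by grind
    have e₃ : G.Adj u x₁ := by grind
    have e₄ : G.Adj u x₂ := by grind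
    refine ⟨x₁, u, x₂, y₁, v, y₂, ?_, e₃, e₄, e₁, e₂⟩
    have := e₁.ne
    have := e₂.ne
    have := e₃.ne
    have := e₄.ne
    have := huv.ne
    simp
    grind
  · left
    push Not at hdom
    obtain ⟨w, hw⟩ := hdom
    obtain ⟨z, hz, w, hw, hzw⟩ := hG.exists_adj_boundary
      (S := {w | w = u ∨ w = v ∨ G.Adj u w ∨ G.Adj v w}) (x := u) (y := w) (by simp)
      (by simpa using hw)
    simp only [Set.mem_ofPred_eq, not_or] at hz hw
    have hne : z ≠ w := hzw.ne
    have hzu : z ≠ u := by rintro rfl; exact hw.2.2.1 hzw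
    have hzv : z ≠ v := by rintro rfl; exact hw.2.2.2 hzw
    have hwx : w ≠ x := by rintro rfl; exact hw.2.2.1 hxu.symm
    have hwy : w ≠ y := by rintro rfl; exact hw.2.2.2 hvy
    by_cases huz : G.Adj u z ∧ z ≠ y
    · refine ⟨w, z, u, v, y, ?_, hzw.symm, huz.1.symm, huv, hvy⟩
      simp
      grind
    · have hvz : G.Adj v z := by
        by_cases h : z = y
        · exact h ▸ hvy
        · grind
      by_cases hzx : z = x
      · subst hzx
        exact absurd ⟨hxu.symm, by grind⟩ huz
      · refine ⟨w, z, v, u, x, ?_, hzw.symm, hvz.symm, huv.symm, hxu.symm⟩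
        simp
        grind

/-- A connected graph on at least six vertices in which every vertex misses two other vertices
contains a matching of size three or two disjoint paths on three vertices. -/
lemma Connected.exists_matching_or_two_cherries [Fintype V] (hG : G.Connected)
    (hcard : 6 ≤ Fintype.card V)
    (hN : ∀ v, ∃ w₁ w₂, w₁ ≠ w₂ ∧ w₁ ≠ v ∧ w₂ ≠ v ∧ ¬ G.Adj v w₁ ∧ ¬ G.Adj v w₂) :
    (∃ x₁ x₂ y₁ y₂ z₁ z₂, [x₁, x₂, y₁, y₂, z₁, z₂].Nodup ∧
      G.Adj x₁ x₂ ∧ G.Adj y₁ y₂ ∧ G.Adj z₁ z₂) ∨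
    (∃ x₁ u x₂ y₁ v y₂, [x₁, u, x₂, y₁, v, y₂].Nodup ∧
      G.Adj u x₁ ∧ G.Adj u x₂ ∧ G.Adj v y₁ ∧ G.Adj v y₂) := by
  classical
  rcases hG.exists_path_five_or_two_cherries hN with ⟨p₀, p₁, p₂, p₃, p₄, hnd, h₀, h₁, h₂, h₃⟩ | h
  · obtain ⟨t, ht⟩ : ∃ t, t ∉ ({p₀, p₁, p₂, p₃, p₄} : Finset V) := by
      by_contra! hcon
      have := Finset.card_le_five (a := p₀) (b := p₁) (c := p₂) (d := p₃) (e := p₄)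
      rw [Finset.eq_univ_of_forall hcon, Finset.card_univ] at this
      omega
    obtain ⟨z, hz, q, hq, hzq⟩ := hG.exists_adj_boundary (S := {x | x ∈ [p₀, p₁, p₂, p₃, p₄]})
      (x := p₀) (y := t) (by simp) (by simpa using ht)
    simp only [Set.mem_ofPred_eq, List.mem_cons, List.not_mem_nil, or_false, not_or] at hz hq
    simp only [List.nodup_cons, List.mem_cons, List.not_mem_nil, or_false, not_or, List.nodup_nil,
      not_false_eq_true, and_true] at hnd
    -- A sixth vertex attached at an even position of the path gives a matching, at an odd position
    -- two paths on three vertices.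
    rcases hz with rfl | rfl | rfl | rfl | rfl
    · exact .inl ⟨z, q, p₁, p₂, p₃, p₄, by simp; grind, hzq, h₁, h₃⟩
    · exact .inr ⟨p₀, z, q, p₂, p₃, p₄, by simp; grind, h₀.symm, hzq, h₂.symm, h₃⟩
    · exact .inl ⟨p₀, p₁, z, q, p₃, p₄, by simp; grind, h₀, hzq, h₃⟩
    · exact .inr ⟨p₀, p₁, p₂, q, z, p₄, by simp; grind, h₀.symm, h₁, hzq, h₃⟩
    · exact .inl ⟨z, q, p₀, p₁, p₂, p₃, by simp; grind, hzq, h₀, h₂⟩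
  · exact .inr h

/-- Giving the edges `s(a₁, b₁)` and `s(a₂, b₂)` of a spanning tree the colors of two other edges
saves two colors, and is harmless if edges of equal color lie in distinct classes of a partition. -/
lemma exists_isConflictFreeConnected_of_recolor [Fintype V] {T : SimpleGraph V}
    (hT : T.IsTree) (hTG : T ≤ G) (hcard : 4 ≤ Fintype.card V) {a₁ b₁ a₂ b₂ a₃ b₃ a₄ b₄ : V}
    (h₁ : T.Adj a₁ b₁) (h₂ : T.Adj a₂ b₂) (h₃ : T.Adj a₃ b₃) (h₄ : T.Adj a₄ b₄)
    (h₁₂ : s(a₁, b₁) ≠ s(a₂, b₂)) {ι : Type*} (κ : V → ι)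
    (hκ₁ : κ a₁ = κ b₁) (hκ₂ : κ a₂ = κ b₂) (hκ₃ : κ a₃ = κ b₃) (hκ₄ : κ a₄ = κ b₄)
    (hκ₁₃ : κ a₁ ≠ κ a₃) (hκ₁₄ : κ a₁ ≠ κ a₄) (hκ₂₃ : κ a₂ ≠ κ a₃) (hκ₂₄ : κ a₂ ≠ κ a₄)
    (hκ₁₂ : s(a₃, b₃) = s(a₄, b₄) → κ a₁ ≠ κ a₂) :
    ∃ c : G.EdgeLabeling (Fin (Fintype.card V - 3)), G.IsConflictFreeConnected c := by
  classical
  have key : ∀ x y a b : V, κ a = κ b → s(x, y) = s(a, b) → κ x = κ a ∧ κ y = κ a := by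
    intro x y a b hab h
    rcases Sym2.eq_iff.mp h with ⟨rfl, rfl⟩ | ⟨rfl, rfl⟩
    · exact ⟨rfl, hab.symm⟩
    · exact ⟨hab.symm, rfl⟩
  have hne : ∀ a b a' b', κ a = κ b → κ a' = κ b' → κ a ≠ κ a' → s(a, b) ≠ s(a', b') :=
    fun a b a' b' h _ h' he ↦ h' (key _ _ _ _ ‹_› he).1
  have h₁₃ := hne _ _ _ _ hκ₁ hκ₃ hκ₁₃
  have h₁₄ := hne _ _ _ _ hκ₁ hκ₄ hκ₁₄
  have h₂₃ := hne _ _ _ _ hκ₂ hκ₃ hκ₂₃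
  have h₂₄ := hne _ _ _ _ hκ₂ hκ₄ hκ₂₄
  -- Colors are the tree edges themselves: n - 1 of them, of which two are no longer used.
  refine exists_isConflictFreeConnected_of_cfJoined (by omega) hTG
    (c := fun e ↦ if e = s(a₁, b₁) then s(a₃, b₃) else if e = s(a₂, b₂) then s(a₄, b₄) else e)
    ((T.edgeFinset.erase s(a₁, b₁)).erase s(a₂, b₂)) ?_ ?_
    (cfJoined_of_partition hT.connected κ ?_)
  · rw [Finset.card_erase_of_mem (by simp [h₂, h₁₂.symm]),
      Finset.card_erase_of_mem (by simpa using h₁)]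
    have := hT.card_edgeFinset
    omega
  · intro e he
    simp only [Finset.mem_erase, mem_edgeFinset]
    rw [← mem_edgeSet] at h₁ h₂ h₃ h₄
    split_ifs with h h'
    · exact ⟨h₂₃.symm, h₁₃.symm, h₃⟩
    · exact ⟨h₂₄.symm, h₁₄.symm, h₄⟩
    · exact ⟨h', h, he⟩
  · intro x y z w _ _ hxy hc
    have k₁ := key x y _ _ hκ₁
    have k₂ := key x y _ _ hκ₂
    have k₃ := key x y _ _ hκ₃
    have k₄ := key x y _ _ hκ₄
    have l₁ := key z w _ _ hκ₁
    have l₂ := key z w _ _ hκ₂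
    have l₃ := key z w _ _ hκ₃
    have l₄ := key z w _ _ hκ₄
    clear key hne
    generalize s(x, y) = e, s(z, w) = f, s(a₁, b₁) = e₁, s(a₂, b₂) = e₂, s(a₃, b₃) = e₃,
      s(a₄, b₄) = e₄ at *
    split_ifs at hc <;> grind

/-- In the matching case all three edges share one color. In the other case each edge of one path is
paired with an edge of the other, which saves two colors as well. -/
theorem Connected.exists_isConflictFreeConnected_card_sub_three [Fintype V] (hG : G.Connected)
    (hcard : 6 ≤ Fintype.card V)
    (hN : ∀ v, ∃ w₁ w₂, w₁ ≠ w₂ ∧ w₁ ≠ v ∧ w₂ ≠ v ∧ ¬ G.Adj v w₁ ∧ ¬ G.Adj v w₂) :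
    ∃ c : G.EdgeLabeling (Fin (Fintype.card V - 3)), G.IsConflictFreeConnected c := by
  classical
  obtain ⟨T, hTG, hT⟩ := hG.exists_isTree_le
  have hN' : ∀ v, ∃ w₁ w₂, w₁ ≠ w₂ ∧ w₁ ≠ v ∧ w₂ ≠ v ∧ ¬ T.Adj v w₁ ∧ ¬ T.Adj v w₂ := by
    intro v
    obtain ⟨w₁, w₂, h, h₁, h₂, h₃, h₄⟩ := hN v
    exact ⟨w₁, w₂, h, h₁, h₂, fun h ↦ h₃ (hTG h), fun h ↦ h₄ (hTG h)⟩
  rcases hT.connected.exists_matching_or_two_cherries hcard hN' with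
    ⟨x₁, x₂, y₁, y₂, z₁, z₂, hnd, h₁, h₂, h₃⟩ | ⟨x₁, u, x₂, y₁, v, y₂, hnd, h₁, h₂, h₃, h₄⟩
  · simp only [List.nodup_cons, List.mem_cons, List.not_mem_nil, or_false, not_or, List.nodup_nil,
      not_false_eq_true, and_true] at hnd
    refine exists_isConflictFreeConnected_of_recolor hT hTG (by omega) h₂ h₃ h₁ h₁ ?_
      (fun t ↦ if t = x₁ ∨ t = x₂ then 0 else if t = y₁ ∨ t = y₂ then 1 else 2) ?_ ?_ ?_ ?_ ?_ ?_
      ?_ ?_ ?_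
    · rw [ne_eq, Sym2.eq_iff]
      grind
    all_goals grind
  · simp only [List.nodup_cons, List.mem_cons, List.not_mem_nil, or_false, not_or, List.nodup_nil,
      not_false_eq_true, and_true] at hnd
    refine exists_isConflictFreeConnected_of_recolor hT hTG (by omega) h₃ h₄ h₁ h₂ ?_
      (fun t ↦ if t = x₁ ∨ t = x₂ ∨ t = u then 0 else 1) ?_ ?_ ?_ ?_ ?_ ?_ ?_ ?_ ?_
    · rw [ne_eq, Sym2.eq_iff]
      grind
    all_goals try rw [Sym2.eq_iff]
    all_goals grind

end Structure

/-! ### The path P₅ and the case n = 5. -/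

section PathGraph

lemma exists_isConflictFreeConnected_of_iso {W : Type*} {G : SimpleGraph V} {H : SimpleGraph W}
    (f : G ≃g H) {k : ℕ} (h : ∃ c : G.EdgeLabeling (Fin k), G.IsConflictFreeConnected c) :
    ∃ c : H.EdgeLabeling (Fin k), H.IsConflictFreeConnected c := by
  obtain ⟨c, hc⟩ := h
  refine ⟨fun e ↦ c (f.mapEdgeSet.symm e), fun u v huv ↦ ?_⟩
  obtain ⟨p, hp, i, e, ⟨he, hi⟩, huniq⟩ := hc (f.symm u) (f.symm v) (by simpa using huv)
  refine ⟨(p.map f.toHom).copy (f.apply_symm_apply u) (f.apply_symm_apply v), ?_, i,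
    f.mapEdgeSet e, ⟨?_, ?_⟩, ?_⟩
  · rw [Walk.isPath_copy]
    exact hp.map f.injective
  · rw [Walk.edges_copy, Walk.edges_map]
    exact List.mem_map_of_mem he
  · change c (f.mapEdgeSet.symm (f.mapEdgeSet e)) = i
    rw [Equiv.symm_apply_apply, hi]
  · rintro e' ⟨he', hi'⟩
    rw [Walk.edges_copy, Walk.edges_map] at he'
    obtain ⟨e₀, he₀, h₀⟩ := List.mem_map.mp he'
    have h : f.mapEdgeSet ⟨e₀, p.edges_subset_edgeSet he₀⟩ = e' := Subtype.ext h₀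
    rw [← h, huniq ⟨e₀, p.edges_subset_edgeSet he₀⟩ ⟨he₀, ?_⟩]
    rw [← hi', ← h]
    exact congrArg c (f.mapEdgeSet.symm_apply_apply _).symm

lemma cfc_eq_of_iso {W : Type*} {G : SimpleGraph V} {H : SimpleGraph W} (f : G ≃g H) :
    G.cfc = H.cfc := by
  unfold cfc
  congr 1
  ext k
  exact ⟨exists_isConflictFreeConnected_of_iso f, exists_isConflictFreeConnected_of_iso f.symm⟩

instance (n : ℕ) : DecidableRel (pathGraph n).Adj := fun _ _ ↦
  decidable_of_iff _ pathGraph_adj.symm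

lemma isTree_pathGraph_five : (pathGraph 5).IsTree := by
  rw [isTree_iff_connected_and_card]
  refine ⟨pathGraph_connected 4, ?_⟩
  rw [Nat.card_eq_fintype_card, Nat.card_eq_fintype_card, ← edgeFinset_card]
  decide

lemma exists_labeling_pathGraph_five : ∃ c : (pathGraph 5).EdgeLabeling (Fin 3),
    (pathGraph 5).IsConflictFreeConnected c := by
  -- The edges 01 and 23 share a color and are separated by the classes {0, 1} and {2, 3, 4}.
  refine exists_isConflictFreeConnected_of_cfJoined (by omega) le_rfl
    (c := fun e ↦ if e = s(2, 3) then s(0, 1) else e) {s(0, 1), s(1, 2), s(3, 4)} (by decide)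
    (by decide) (cfJoined_of_partition (pathGraph_connected 4) (fun x : Fin 5 ↦ decide (x ≤ 1)) ?_)
  decide

lemma Walk.IsConflictFree.exists_mem_edges {K : Type*} {G : SimpleGraph V} {c : G.EdgeLabeling K}
    {C : Sym2 V → K} (hC : ∀ e : G.edgeSet, C e = c e) {u v : V} {p : G.Walk u v}
    (hp : p.IsConflictFree c) : ∃ e ∈ p.edges, ∀ e' ∈ p.edges, C e' = C e → e' = e := by
  obtain ⟨i, e, ⟨he, hi⟩, huniq⟩ := hp
  refine ⟨e, he, fun e' he' h ↦ ?_⟩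
  have := hC ⟨e', p.edges_subset_edgeSet he'⟩
  exact congrArg Subtype.val (huniq ⟨e', p.edges_subset_edgeSet he'⟩
    ⟨he', by rw [← this, h, hC, hi]⟩)

/-- Paths in a forest are unique, so every nontrivial path must be conflict-free. Non-edges receive
a junk color in `C`. -/
lemma IsAcyclic.exists_mem_edges {K : Type*} [Nonempty K] {G : SimpleGraph V} (hG : G.IsAcyclic)
    {c : G.EdgeLabeling K} (hc : G.IsConflictFreeConnected c) : ∃ C : Sym2 V → K,
    ∀ {u v : V} (p : G.Walk u v), p.IsPath → u ≠ v →
      ∃ e ∈ p.edges, ∀ e' ∈ p.edges, C e' = C e → e' = e := by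
  classical
  let C : Sym2 V → K := fun e ↦ if h : e ∈ G.edgeSet then c ⟨e, h⟩ else Classical.arbitrary K
  refine ⟨C, fun {u v} p hp huv ↦ ?_⟩
  obtain ⟨q, hq, h⟩ := hc u v huv
  have hpq : p = q := congrArg Subtype.val ((hG.subsingleton_path u v).elim ⟨p, hp⟩ ⟨q, hq⟩)
  subst hpq
  exact h.exists_mem_edges (C := C) (fun e ↦ by simp [C])

lemma cfc_pathGraph_five : (pathGraph 5).cfc = 3 := by
  refine le_antisymm (Nat.sInf_le exists_labeling_pathGraph_five) ?_
  have hmem := Nat.sInf_mem (s := {k : ℕ | ∃ c : (pathGraph 5).EdgeLabeling (Fin k),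
    (pathGraph 5).IsConflictFreeConnected c}) ⟨3, exists_labeling_pathGraph_five⟩
  change 3 ≤ sInf _
  generalize sInf {k : ℕ | ∃ c : (pathGraph 5).EdgeLabeling (Fin k),
    (pathGraph 5).IsConflictFreeConnected c} = k at hmem
  obtain ⟨c, hc⟩ := hmem
  have h₀₁ : (pathGraph 5).Adj 0 1 := by decide
  have h₁₂ : (pathGraph 5).Adj 1 2 := by decide
  have h₂₃ : (pathGraph 5).Adj 2 3 := by decide
  have h₃₄ : (pathGraph 5).Adj 3 4 := by decide
  have : Nonempty (Fin k) := ⟨c ⟨s(0, 1), h₀₁⟩⟩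
  obtain ⟨C, hC⟩ := isTree_pathGraph_five.isAcyclic.exists_mem_edges hc
  have e₁ := hC (.cons h₀₁ (.cons h₁₂ .nil)) (by simp) (by decide)
  have e₂ := hC (.cons h₁₂ (.cons h₂₃ .nil)) (by simp) (by decide)
  have e₃ := hC (.cons h₂₃ (.cons h₃₄ .nil)) (by simp) (by decide)
  have e₄ := hC (.cons h₀₁ (.cons h₁₂ (.cons h₂₃ (.cons h₃₄ .nil)))) (by simp) (by decide)
  simp only [Walk.edges_cons, Walk.edges_nil, List.mem_cons, List.not_mem_nil, or_false,
    exists_eq_or_imp, exists_eq_left, forall_eq_or_imp, forall_eq] at e₁ e₂ e₃ e₄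
  have d₁ : (s(0, 1) : Sym2 (Fin 5)) ≠ s(1, 2) := by decide
  have d₂ : (s(1, 2) : Sym2 (Fin 5)) ≠ s(2, 3) := by decide
  have d₃ : (s(2, 3) : Sym2 (Fin 5)) ≠ s(3, 4) := by decide
  have d₄ : (s(0, 1) : Sym2 (Fin 5)) ≠ s(2, 3) := by decide
  have d₅ : (s(1, 2) : Sym2 (Fin 5)) ≠ s(3, 4) := by decide
  generalize (s(0, 1) : Sym2 (Fin 5)) = a at *
  generalize (s(1, 2) : Sym2 (Fin 5)) = b at *
  generalize (s(2, 3) : Sym2 (Fin 5)) = d at *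
  generalize (s(3, 4) : Sym2 (Fin 5)) = e at *
  by_contra! hk
  have n₁ : C a ≠ C b := by grind
  have n₂ : C b ≠ C d := by grind
  have n₃ : C d ≠ C e := by grind
  -- Two colors would have to alternate, so each would occur twice on the whole path.
  have q₁ : C a = C d := by omega
  have q₂ : C b = C e := by omega
  grind

/-- A connected, bridged graph on five vertices in which every vertex misses two other vertices is
a path. -/
lemma Connected.nonempty_iso_pathGraph_five [Fintype V] {H : SimpleGraph V} (hH : H.Connected)
    (hcard : Fintype.card V = 5)
    (hN : ∀ v, ∃ w₁ w₂, w₁ ≠ w₂ ∧ w₁ ≠ v ∧ w₂ ≠ v ∧ ¬ H.Adj v w₁ ∧ ¬ H.Adj v w₂)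
    {A : Set V} {a b : V} (ha : a ∈ A) (hb : b ∉ A)
    (hcut : ∀ x ∈ A, ∀ y ∉ A, H.Adj x y → x = a ∧ y = b) :
    Nonempty (H ≃g pathGraph 5) := by
  classical
  rcases hH.exists_path_five_or_two_cherries hN with
    ⟨p₀, p₁, p₂, p₃, p₄, hnd, h₀, h₁, h₂, h₃⟩ | ⟨x₁, u, x₂, y₁, v, y₂, hnd, -⟩
  · let f : Fin 5 → V := ![p₀, p₁, p₂, p₃, p₄]
    have hf : Function.Bijective f := by
      rw [Fintype.bijective_iff_injective_and_card]
      refine ⟨?_, by simp [hcard]⟩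
      rw [← List.nodup_ofFn]
      simpa [f, List.ofFn_succ] using hnd
    have hall : ∀ w, w = p₀ ∨ w = p₁ ∨ w = p₂ ∨ w = p₃ ∨ w = p₄ := by
      intro w
      obtain ⟨i, rfl⟩ := hf.2 w
      fin_cases i <;> simp [f]
    simp only [List.nodup_cons, List.mem_cons, List.not_mem_nil, or_false, not_or, List.nodup_nil,
      not_false_eq_true, and_true] at hnd
    have g₀ := h₀.symm
    have g₁ := h₁.symm
    have g₂ := h₂.symm
    have g₃ := h₃.symm
    have hsymm : ∀ x y, H.Adj x y → H.Adj y x := fun _ _ h ↦ h.symm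
    -- An inner vertex of the path has no further neighbor.
    have hin : ∀ v x y z, H.Adj v x → H.Adj v y → x ≠ y → z ≠ x → z ≠ y → ¬ H.Adj v z := by
      intro v x y z hx hy hxy hzx hzy hz
      obtain ⟨w₁, w₂, hw, hw₁, hw₂, k₁, k₂⟩ := hN v
      have : ([v, x, y, z, w₁, w₂] : List V).Nodup := by
        have := hx.ne
        have := hy.ne
        have := hz.ne
        simp
        grind
      have := this.length_le_card
      simp [hcard] at this
    have n₁ : ¬ H.Adj p₀ p₂ := fun h ↦ hin p₂ p₁ p₃ p₀ g₁ h₂ (by grind) (by grind) (by grind) h.symm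
    have n₂ : ¬ H.Adj p₀ p₃ := fun h ↦ hin p₃ p₂ p₄ p₀ g₂ h₃ (by grind) (by grind) (by grind) h.symm
    have n₃ : ¬ H.Adj p₁ p₃ := hin p₁ p₀ p₂ p₃ g₀ h₁ (by grind) (by grind) (by grind)
    have n₄ : ¬ H.Adj p₁ p₄ := hin p₁ p₀ p₂ p₄ g₀ h₁ (by grind) (by grind) (by grind)
    have n₅ : ¬ H.Adj p₂ p₄ := hin p₂ p₁ p₃ p₄ g₁ h₂ (by grind) (by grind) (by grind)
    -- This edge would close a 5-cycle through all vertices, and every cut meets a cycle in at least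
    -- two edges.
    have n₆ : ¬ H.Adj p₀ p₄ := by
      intro h
      have c₀ := hcut p₀
      have c₁ := hcut p₁
      have c₂ := hcut p₂
      have c₃ := hcut p₃
      have c₄ := hcut p₄
      have k := h.symm
      have ha' := hall a
      have hb' := hall b
      clear hin hN hcut hall hsymm hf
      by_cases m₀ : p₀ ∈ A <;> by_cases m₁ : p₁ ∈ A <;> by_cases m₂ : p₂ ∈ A <;>
        by_cases m₃ : p₃ ∈ A <;> by_cases m₄ : p₄ ∈ A <;> grind
    refine ⟨(RelIso.mk (Equiv.ofBijective f hf) ?_ : pathGraph 5 ≃g H).symm⟩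
    intro i j
    have m₁ := mt (hsymm p₂ p₀) n₁
    have m₂ := mt (hsymm p₃ p₀) n₂
    have m₃ := mt (hsymm p₃ p₁) n₃
    have m₄ := mt (hsymm p₄ p₁) n₄
    have m₅ := mt (hsymm p₄ p₂) n₅
    have m₆ := mt (hsymm p₄ p₀) n₆
    fin_cases i <;> fin_cases j <;> simp [f, pathGraph_adj, *]
  · have := hnd.length_le_card
    simp [hcard] at this

end PathGraph

/-! ### Bridges of the complement. -/

section EdgeConnectivity

lemma Connected.exists_labeling [Fintype V] {G : SimpleGraph V} (hG : G.Connected) :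
    {k : ℕ | ∃ c : G.EdgeLabeling (Fin k), G.IsConflictFreeConnected c}.Nonempty := by
  classical
  exact ⟨Fintype.card (Sym2 V) + 1, exists_isConflictFreeConnected_of_cfJoined (by omega) le_rfl
    (c := id) Finset.univ (by simp) (by simp)
    (cfJoined_of_partition hG (fun _ ↦ ()) fun _ _ _ _ _ _ h h' ↦ absurd h' h)⟩

/-- The value 1 is attained, since the infimum of an empty set is 0; the graph is connected, since
otherwise deleting nothing would give 0. -/
lemma exists_cut_of_edgeConnectivity_eq_one {H : SimpleGraph V} (h : H.edgeConnectivity = 1) :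
    H.Connected ∧ ∃ (A : Set V) (a b : V), a ∈ A ∧ b ∉ A ∧ H.Adj a b ∧
      ∀ x ∈ A, ∀ y ∉ A, H.Adj x y → x = a ∧ y = b := by
  have hne := Nat.nonempty_of_sInf_eq_succ h
  obtain ⟨S, hS, hcard, hdis⟩ := Nat.sInf_mem hne
  change S.card = H.edgeConnectivity at hcard
  rw [h, Finset.card_eq_one] at hcard
  obtain ⟨e, rfl⟩ := hcard
  have hH : H.Connected := by
    by_contra hcon
    have : H.edgeConnectivity ≤ 0 := Nat.sInf_le ⟨∅, by simp, by simp, by simpa using hcon⟩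
    omega
  refine ⟨hH, ?_⟩
  induction e with | _ a b
  rw [Finset.coe_singleton] at hdis hS
  have hab : H.Adj a b := by simpa using hS
  have hb : ¬ (H.deleteEdges {s(a, b)}).Reachable a b := by
    by_contra hcon
    exact hdis (hH.connected_delete_edge_of_not_isBridge (by rwa [isBridge_iff, not_not]))
  refine ⟨{x | (H.deleteEdges {s(a, b)}).Reachable a x}, a, b, .refl a, hb, hab, ?_⟩
  intro x hx y hy hxy
  have he : s(x, y) = s(a, b) := by
    by_contra hne
    exact hy (hx.trans (Adj.reachable (by simp [deleteEdges_adj, hxy, hne])))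
  rcases Sym2.eq_iff.mp he with h | ⟨rfl, rfl⟩
  · exact h
  · exact absurd hx hb

lemma IsEdgeConnected.exists_two_adj [Finite V] [Nontrivial V] {G : SimpleGraph V}
    (hG : G.IsEdgeConnected 2) (v : V) : ∃ w₁ w₂, w₁ ≠ w₂ ∧ G.Adj v w₁ ∧ G.Adj v w₂ := by
  classical
  have := Fintype.ofFinite V
  obtain ⟨w₁, h₁, w₂, h₂, h⟩ := Finset.one_lt_card.mp (hG.le_degree (u := v))
  exact ⟨w₁, w₂, h, by simpa using h₁, by simpa using h₂⟩

/-- A 2-edge-connected graph whose complement has a bridge is conflict-free connected with two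
colors. -/
lemma IsEdgeConnected.cfc_le_two [Fintype V] {G : SimpleGraph V} (hG : G.IsEdgeConnected 2)
    {A : Set V} {a b : V} (ha : a ∈ A) (hb : b ∉ A) (hab : ¬ G.Adj a b)
    (hcut : ∀ x ∈ A, ∀ y ∉ A, ¬ G.Adj x y → x = a ∧ y = b) : G.cfc ≤ 2 := by
  have hne : a ≠ b := by rintro rfl; exact hb ha
  have : Nontrivial V := ⟨a, b, hne⟩
  by_cases hA : ∃ a' ∈ A, a ≠ a'
  · obtain ⟨a', ha', haa'⟩ := hA
    by_cases hB : ∃ b' ∉ A, b ≠ b'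
    · obtain ⟨b', hb', hbb'⟩ := hB
      exact cfc_le_two_of_bipartite ha hb ha' hb' haa' hbb' (by grind)
    · push Not at hB
      refine cfc_le_two_of_almost_universal hne.symm (fun h ↦ hab h.symm) (fun x hxb hxa ↦ ?_)
        hG.exists_two_adj
      have hx : x ∈ A := by
        by_contra hx
        exact hxb (hB x hx).symm
      by_contra h
      exact hxa (hcut x hx b hb fun h' ↦ h h'.symm).1
  · push Not at hA
    refine cfc_le_two_of_almost_universal hne hab (fun x hxa hxb ↦ ?_) hG.exists_two_adj
    by_contra h
    exact hxb (hcut a ha x (fun hx ↦ hxa (hA x hx).symm) h).2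

/-! ### Sharpness: two cliques joined by a bridge. -/

/-- If two vertices of each side of a partition are adjacent to all of the other side, then the
graph is 2-edge-connected. -/
lemma isEdgeConnected_two_of_bipartite {G : SimpleGraph V} {A : Set V} {a₁ a₂ b₁ b₂ : V}
    (ha₁ : a₁ ∈ A) (ha₂ : a₂ ∈ A) (hb₁ : b₁ ∉ A) (hb₂ : b₂ ∉ A) (ha : a₁ ≠ a₂) (hb : b₁ ≠ b₂)
    (h₁ : ∀ y ∉ A, G.Adj a₁ y) (h₂ : ∀ y ∉ A, G.Adj a₂ y) (h₃ : ∀ x ∈ A, G.Adj x b₁)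
    (h₄ : ∀ x ∈ A, G.Adj x b₂) : G.IsEdgeConnected 2 := by
  rw [isEdgeConnected_two]
  intro e
  have hadj : ∀ {x y}, G.Adj x y → s(x, y) ≠ e → (G.deleteEdges {e}).Reachable x y :=
    fun h h' ↦ Adj.reachable (by simp [deleteEdges_adj, h, h'])
  -- The routes through `b₁` and `b₂` share no edge, so `e` blocks at most one.
  have hA : ∀ x ∈ A, (G.deleteEdges {e}).Reachable x a₁ := by
    intro x hx
    by_cases h : s(x, b₁) = e ∨ s(a₁, b₁) = e
    · refine (hadj (h₄ x hx) ?_).trans (hadj (h₄ a₁ ha₁) ?_).symm <;>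
      · rintro rfl
        simp only [Sym2.eq_iff] at h
        grind
    · push Not at h
      exact (hadj (h₃ x hx) h.1).trans (hadj (h₃ a₁ ha₁) h.2).symm
  have hB : ∀ y ∉ A, (G.deleteEdges {e}).Reachable y b₁ := by
    intro y hy
    by_cases h : s(a₁, y) = e ∨ s(a₁, b₁) = e
    · refine (hadj (h₂ y hy) ?_).symm.trans (hadj (h₂ b₁ hb₁) ?_) <;>
      · rintro rfl
        simp only [Sym2.eq_iff] at h
        grind
    · push Not at h
      exact (hadj (h₁ y hy) h.1).symm.trans (hadj (h₁ b₁ hb₁) h.2)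
  have hcross : (G.deleteEdges {e}).Reachable b₁ a₁ := by
    by_cases h : s(a₁, b₁) = e
    · refine ((hB b₂ hb₂).symm.trans (hadj (h₁ b₂ hb₂) ?_).symm)
      rintro rfl
      simp only [Sym2.eq_iff] at h
      grind
    · exact (hadj (h₁ b₁ hb₁) h).symm
  have hall : ∀ x, (G.deleteEdges {e}).Reachable x a₁ := by
    intro x
    by_cases hx : x ∈ A
    · exact hA x hx
    · exact (hB x hx).trans hcross
  exact fun x y ↦ (hall x).trans (hall y).symm

/-- Two cliques, on the vertices of a set and of its complement, joined by the edge `s(a, b)`. -/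
def bridgedCliques (A : Set V) (a b : V) : SimpleGraph V :=
  fromRel fun x y ↦ (x ∈ A ↔ y ∈ A) ∨ x = a ∧ y = b

section bridgedCliques

variable {A : Set V} {a b : V}

lemma bridgedCliques_adj_of_mem (hb : b ∉ A) {x y : V} (hx : x ∈ A) (hy : y ∉ A) :
    (bridgedCliques A a b).Adj x y ↔ x = a ∧ y = b := by
  simp only [bridgedCliques, fromRel_adj]
  grind

lemma bridgedCliques_adj_of_iff {x y : V} (hxy : x ≠ y) (h : x ∈ A ↔ y ∈ A) :
    (bridgedCliques A a b).Adj x y := by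
  simp only [bridgedCliques, fromRel_adj]
  grind

lemma bridgedCliques_connected (ha : a ∈ A) (hb : b ∉ A) : (bridgedCliques A a b).Connected := by
  rw [connected_iff_exists_forall_reachable]
  have hab : (bridgedCliques A a b).Adj a b := (bridgedCliques_adj_of_mem hb ha hb).mpr ⟨rfl, rfl⟩
  refine ⟨a, fun x ↦ ?_⟩
  by_cases hx : x ∈ A
  · by_cases hxa : a = x
    · rw [hxa]
    · exact (bridgedCliques_adj_of_iff hxa (by grind)).reachable
  · refine hab.reachable.trans ?_
    by_cases hxb : b = x
    · rw [hxb]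
    · exact (bridgedCliques_adj_of_iff hxb (by grind)).reachable

lemma edgeConnectivity_bridgedCliques (ha : a ∈ A) (hb : b ∉ A) :
    (bridgedCliques A a b).edgeConnectivity = 1 := by
  have hab : (bridgedCliques A a b).Adj a b := (bridgedCliques_adj_of_mem hb ha hb).mpr ⟨rfl, rfl⟩
  have hmem : 1 ∈ {k : ℕ | ∃ S : Finset (Sym2 V),
      (S : Set (Sym2 V)) ⊆ (bridgedCliques A a b).edgeSet ∧ S.card = k ∧
      ¬ ((bridgedCliques A a b).deleteEdges (S : Set (Sym2 V))).Connected} := by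
    refine ⟨{s(a, b)}, by simpa using hab, by simp, fun hcon ↦ ?_⟩
    obtain ⟨x, hx, y, hy, hxy⟩ := hcon.exists_adj_boundary ha hb
    rw [deleteEdges_adj] at hxy
    obtain ⟨rfl, rfl⟩ := (bridgedCliques_adj_of_mem hb hx hy).mp hxy.1
    exact hxy.2 (by simp)
  refine le_antisymm (Nat.sInf_le hmem) (Nat.one_le_iff_ne_zero.mpr fun h ↦ ?_)
  rcases Nat.sInf_eq_zero.mp h with ⟨S, -, hS, hcon⟩ | h
  · rw [Finset.card_eq_zero.mp hS] at hcon
    exact hcon (by simpa using bridgedCliques_connected ha hb)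
  · exact h.le hmem

/-- The bridge gets a color of its own, and any path between the cliques uses it exactly once. -/
lemma cfc_bridgedCliques_le_two (ha : a ∈ A) (hb : b ∉ A) : (bridgedCliques A a b).cfc ≤ 2 := by
  classical
  have hab : (bridgedCliques A a b).Adj a b := (bridgedCliques_adj_of_mem hb ha hb).mpr ⟨rfl, rfl⟩
  let c : Sym2 V → Bool := fun e ↦ decide (e = s(a, b))
  have hc : c s(a, b) = true := by simp [c]
  have hcf : ∀ x y, (x ∈ A ↔ y ∈ A) → c s(x, y) = false := by
    intro x y h
    simp only [c, decide_eq_false_iff_not, Sym2.eq_iff]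
    grind
  have hcross : ∀ x ∈ A, ∀ y ∉ A, (bridgedCliques A a b).CFJoined c x y := by
    intro x hx y hy
    by_cases hxa : x = a <;> by_cases hyb : y = b
    · exact ((bridgedCliques_adj_of_mem hb hx hy).mpr ⟨hxa, hyb⟩).cfJoined
    · subst hxa
      exact cfJoined_of_two_edges hab (bridgedCliques_adj_of_iff (Ne.symm hyb) (by grind))
        (by grind) (by rw [hc, hcf _ _ (by grind)]; simp)
    · subst hyb
      exact cfJoined_of_two_edges (bridgedCliques_adj_of_iff hxa (by grind)) hab
        (by grind) (by rw [hc, hcf _ _ (by grind)]; simp)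
    · exact cfJoined_of_three_edges (bridgedCliques_adj_of_iff hxa (by grind)) hab
        (bridgedCliques_adj_of_iff (Ne.symm hyb) (by grind)) (by grind) (by grind) (by grind)
        (by rw [hc, hcf _ _ (by grind)]; simp)
  refine cfc_le_two_of_cfJoined (c := c) fun x y hxy ↦ ?_
  by_cases hx : x ∈ A <;> by_cases hy : y ∈ A
  · exact (bridgedCliques_adj_of_iff hxy (by grind)).cfJoined
  · exact hcross x hx y hy
  · exact (hcross y hy x hx).symm
  · exact (bridgedCliques_adj_of_iff hxy (by grind)).cfJoined

end bridgedCliques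

/-! ### Assembly. -/

/-- The conflict-free connection numbers of a 2-edge-connected graph and of its complement, if the
latter has edge-connectivity one. -/
theorem IsEdgeConnected.cfc_and_cfc_compl [Fintype V] {G : SimpleGraph V}
    (hcard : 5 ≤ Fintype.card V) (hG : G.IsEdgeConnected 2) (hH : Gᶜ.edgeConnectivity = 1) :
    G.cfc = 2 ∧ 2 ≤ Gᶜ.cfc ∧
      (Gᶜ.cfc = Fintype.card V - 2 ∧ Nonempty (Gᶜ ≃g pathGraph 5) ∨
        Gᶜ.cfc ≤ Fintype.card V - 3 ∧ ¬ Nonempty (Gᶜ ≃g pathGraph 5)) := by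
  obtain ⟨hconn, A, a, b, ha, hb, hab, hcut⟩ := exists_cut_of_edgeConnectivity_eq_one hH
  have hab' := ((compl_adj G a b).mp hab).2
  have : Nontrivial V := ⟨a, b, hab.ne⟩
  have hN : ∀ v, ∃ w₁ w₂, w₁ ≠ w₂ ∧ w₁ ≠ v ∧ w₂ ≠ v ∧ ¬ Gᶜ.Adj v w₁ ∧ ¬ Gᶜ.Adj v w₂ := by
    intro v
    obtain ⟨w₁, w₂, h, h₁, h₂⟩ := hG.exists_two_adj v
    exact ⟨w₁, w₂, h, h₁.ne', h₂.ne', by simp [h₁], by simp [h₂]⟩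
  have hcutG : ∀ x ∈ A, ∀ y ∉ A, ¬ G.Adj x y → x = a ∧ y = b := fun x hx y hy h ↦
    hcut x hx y hy ((compl_adj G x y).mpr ⟨by grind, h⟩)
  refine ⟨le_antisymm (hG.cfc_le_two ha hb hab' hcutG)
    (two_le_cfc hab.ne hab' (hG.connected two_ne_zero).exists_labeling), ?_, ?_⟩
  · obtain ⟨w, -, -, hw, -, haw, -⟩ := hN a
    exact two_le_cfc hw.symm haw hconn.exists_labeling
  · rcases hcard.eq_or_lt with h | h
    · left
      have hiso := hconn.nonempty_iso_pathGraph_five h.symm hN ha hb hcut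
      refine ⟨?_, hiso⟩
      rw [cfc_eq_of_iso hiso.some, cfc_pathGraph_five, ← h]
    · right
      refine ⟨Nat.sInf_le (hconn.exists_isConflictFreeConnected_card_sub_three h hN), ?_⟩
      rintro ⟨f⟩
      have := Fintype.card_congr f.toEquiv
      simp only [Fintype.card_fin] at this
      omega

end EdgeConnectivity

end SimpleGraph

open SimpleGraph in
theorem exists_cfc_and_cfc_compl_eq_two {n : ℕ} (hn : 6 ≤ n) : ∃ G : SimpleGraph (Fin n),
    G.IsEdgeConnected 2 ∧ Gᶜ.edgeConnectivity = 1 ∧ G.cfc = 2 ∧ Gᶜ.cfc = 2 := by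
  -- The bridge is 23. As n ≥ 6, each side keeps two vertices off the bridge: 0, 1 and 4, 5.
  let A : Set (Fin n) := {x | x.val < 3}
  let v (i : ℕ) (hi : i < 6) : Fin n := ⟨i, by omega⟩
  have hv : ∀ i j hi hj, i ≠ j → v i hi ≠ v j hj := by
    intro i j hi hj h h'
    exact h (congrArg Fin.val h')
  have hA : ∀ i hi, i < 3 → v i hi ∈ A := fun i hi h ↦ h
  have hA' : ∀ i hi, 3 ≤ i → v i hi ∉ A := fun i hi h h' ↦ absurd (show i < 3 from h') (by omega)
  let a := v 2 (by omega)
  let b := v 3 (by omega)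
  have ha : a ∈ A := hA 2 (by omega) (by omega)
  have hb : b ∉ A := hA' 3 (by omega) (by omega)
  have hadj : ∀ x ∈ A, ∀ y ∉ A, ¬ (x = a ∧ y = b) → (bridgedCliques A a b)ᶜ.Adj x y := by
    intro x hx y hy h
    rw [compl_adj, bridgedCliques_adj_of_mem hb hx hy]
    exact ⟨by grind, h⟩
  have hG : (bridgedCliques A a b)ᶜ.IsEdgeConnected 2 := by
    refine isEdgeConnected_two_of_bipartite (hA 0 (by omega) (by omega)) (hA 1 (by omega) (by omega))
      (hA' 4 (by omega) (by omega)) (hA' 5 (by omega) (by omega))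
      (hv 0 1 (by omega) (by omega) (by omega)) (hv 4 5 (by omega) (by omega) (by omega))
      (fun y hy ↦ hadj _ (hA 0 (by omega) (by omega)) y hy ?_)
      (fun y hy ↦ hadj _ (hA 1 (by omega) (by omega)) y hy ?_)
      (fun x hx ↦ hadj x hx _ (hA' 4 (by omega) (by omega)) ?_)
      (fun x hx ↦ hadj x hx _ (hA' 5 (by omega) (by omega)) ?_)
    · exact fun h ↦ hv 0 2 (by omega) (by omega) (by omega) h.1
    · exact fun h ↦ hv 1 2 (by omega) (by omega) (by omega) h.1
    · exact fun h ↦ hv 4 3 (by omega) (by omega) (by omega) h.2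
    · exact fun h ↦ hv 5 3 (by omega) (by omega) (by omega) h.2
  have hconn : (bridgedCliques A a b)ᶜᶜ.edgeConnectivity = 1 := by
    rw [compl_compl]
    exact edgeConnectivity_bridgedCliques ha hb
  obtain ⟨h₁, h₂, -⟩ := hG.cfc_and_cfc_compl (by simpa using by omega) hconn
  refine ⟨_, hG, hconn, h₁, le_antisymm ?_ h₂⟩
  rw [compl_compl]
  exact cfc_bridgedCliques_le_two ha hb

theorem mainTheorem9 :
    (∀ (V : Type*) [Fintype V] (G : SimpleGraph V) (n : ℕ), Fintype.card V = n → 5 ≤ n →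
      G.IsEdgeConnected 2 → Gᶜ.edgeConnectivity = 1 →
      (4 ≤ G.cfc + Gᶜ.cfc ∧ G.cfc + Gᶜ.cfc ≤ n) ∧
      (4 ≤ G.cfc * Gᶜ.cfc ∧ G.cfc * Gᶜ.cfc ≤ 2 * (n - 2)) ∧
      (G.cfc + Gᶜ.cfc = n ↔ Nonempty (Gᶜ ≃g SimpleGraph.pathGraph 5)) ∧
      (G.cfc * Gᶜ.cfc = 2 * (n - 2) ↔ Nonempty (Gᶜ ≃g SimpleGraph.pathGraph 5))) ∧
    (∀ n : ℕ, 6 ≤ n → ∃ G : SimpleGraph (Fin n),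
      G.IsEdgeConnected 2 ∧ Gᶜ.edgeConnectivity = 1 ∧
      G.cfc + Gᶜ.cfc = 4 ∧ G.cfc * Gᶜ.cfc = 4) := by
  refine ⟨fun V _ G n hn h5 hG hH ↦ ?_, fun n hn ↦ ?_⟩
  · subst hn
    obtain ⟨h₁, h₂, h₃⟩ := hG.cfc_and_cfc_compl h5 hH
    rw [h₁]
    rcases h₃ with ⟨h, hiso⟩ | ⟨h, hiso⟩ <;> simp only [hiso, iff_true, iff_false] <;> omega
  · obtain ⟨G, hG, hH, h₁, h₂⟩ := exists_cfc_and_cfc_compl_eq_two hn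
    exact ⟨G, hG, hH, by rw [h₁, h₂], by rw [h₁, h₂]⟩
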